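/- Let $\alpha\in(0,1]$ and $\mu>0$. For $\eta,\nu,\tau>0$ and $w\in\mathbb R$ let $$E_{\eta,\nu}^{\tau}(w)=\sum_{j=0}^{\infty}\frac{(\tau)_j}{j!\,\Gamma(\eta j+\nu)}\,w^j,\qquad (\tau)_j=\frac{\Gamma(\tau+j)}{\Gamma(\tau)},$$ be the generalized Mittag-Leffler function. A random variable $X$ with values in $\mathbb N=\{0,1,2,\dots\}$ has the generalized fractional Poisson distribution gfPd$(\alpha,\beta,\delta,\mu)$, where $\alpha,\beta\in(0,1]$ and $\delta\in(0,\beta/\alpha]$, if $$P(X=x)=\frac{\Gamma(\delta+x)}{x!\,\Gamma(\delta)}\,\mu^x\,\Gamma(\beta)\,E_{\alpha,\alpha x+\beta}^{\delta+x}(-\mu)\qquad\text{for all }x\in\mathbb N.$$ Let $X_{\alpha,\alpha}$ have the distribution gfPd$(\alpha,\alpha,1,\mu)$, and let $S$ be a positive $\alpha$-stable random variable with Laplace transform $\mathbf E[e^{-tS}]=\exp(-t^\alpha)$, $t\ge 0$ (for $\alpha=1$ this means $S=1$ almost surely), and with law $\nu_S$. Then for every $x\in\mathbb N$ the function $y\mapsto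 y^{-\alpha(x+1)}e^{-\mu y^{-\alpha}}$ is $\nu_S$-integrable on $(0,\infty)$ and $$P(X_{\alpha,\alpha}=x)=\Gamma(\alpha+1)\,\frac{\mu^x}{x!}\int_0^\infty y^{-\alpha(x+1)}\,e^{-\mu y^{-\alpha}}\,\nu_S(dy).$$ -/

import Mathlib

open MeasureTheory

/-- The generalized (three-parameter, Prabhakar) Mittag-Leffler function
`E_{η,ν}^τ(w) = ∑_{j ≥ 0} (τ)_j / (j! Γ(η j + ν)) w^j`, with `(τ)_j = Γ(τ + j) / Γ(τ)`,
for real parameters `η, ν, τ > 0` and real argument `w`. -/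
noncomputable def mittagLeffler (η ν τ w : ℝ) : ℝ :=
  ∑' j : ℕ, (Real.Gamma (τ + j) / Real.Gamma τ) /
    ((j.factorial : ℝ) * Real.Gamma (η * j + ν)) * w ^ j

/-- The mass at `x` of the generalized fractional Poisson distribution `gfPd(α, β, δ, μ)`. -/
noncomputable def gfPdMass (α β δ μ : ℝ) (x : ℕ) : ℝ :=
  Real.Gamma (δ + x) / ((x.factorial : ℝ) * Real.Gamma δ) * μ ^ x * Real.Gamma β *
    mittagLeffler α (α * x + β) (δ + x) (-μ)

/-- The random variable `X` on `(Ω, P)` has the distribution `gfPd(α, β, δ, μ)`. -/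
structure HasGfPd {Ω : Type*} [MeasurableSpace Ω] (X : Ω → ℕ) (P : Measure Ω)
    (α β δ μ : ℝ) : Prop where
  aemeasurable : AEMeasurable X P
  mass : ∀ x : ℕ, P.real {ω | X ω = x} = gfPdMass α β δ μ x

/-- The random variable `S` on `(Ω, P)` is positive `α`-stable, normalized so that its
Laplace transform is `E[exp (-t S)] = exp (-t ^ α)` for all `t ≥ 0`. -/
structure IsPositiveStable {Ω : Type*} [MeasurableSpace Ω] (S : Ω → ℝ) (P : Measure Ω)
    (α : ℝ) : Prop where
  aemeasurable : AEMeasurable S P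
  pos : ∀ᵐ ω ∂P, 0 < S ω
  laplace : ∀ t : ℝ, 0 ≤ t → ∫ ω, Real.exp (-(t * S ω)) ∂P = Real.exp (-(t ^ α))

/-!
Euler's integral `Γ(s) y^{-s} = ∫₀^∞ t^{s-1} e^{-ty} dt` and Tonelli turn the Laplace transform
`exp (-t ^ α)` of `S` into its negative moments `E[S^{-s}] = Γ(s/α) / (α Γ(s))`. For `s = α (τ + j)`
these are, up to the factor `w^j / j!`, the terms of the series `Γ(τ)/α · E_{α,ατ}^τ(w)`, so
expanding `e^{w S^{-α}}` and integrating termwise identifies this series with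
`E[S^{-ατ} e^{w S^{-α}}]`. The interchange is legitimate because the Mittag-Leffler series
converges absolutely: log-convexity of `Γ` gives `Γ(s) / Γ(s + η) → 0`, hence the ratio test.
-/

open Filter Topology

theorem rpow_mul_Gamma_le_Gamma_add {s a : ℝ} (hs : 1 < s) (ha : 0 ≤ a) :
    (s - 1) ^ a * Real.Gamma s ≤ Real.Gamma (s + a) := by
  rcases ha.eq_or_lt with rfl | ha
  · simp
  have hs0 : 0 < s - 1 := sub_pos.2 hs
  have hΓ : 0 < Real.Gamma (s - 1) := Real.Gamma_pos_of_pos hs0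
  have hΓs : Real.Gamma s = (s - 1) * Real.Gamma (s - 1) := by
    rw [← Real.Gamma_add_one hs0.ne', sub_add_cancel]
  have hΓsa : 0 < Real.Gamma (s + a) := Real.Gamma_pos_of_pos (by linarith)
  have hslope : Real.log (s - 1) ≤
      (Real.log (Real.Gamma (s + a)) - Real.log (Real.Gamma s)) / a := by
    have h := Real.convexOn_log_Gamma.slope_mono_adjacent (x := s - 1) (y := s) (z := s + a)
      hs0 (Set.mem_Ioi.2 (by linarith)) (by linarith) (by linarith)
    simpa only [Function.comp_apply, sub_sub_cancel, div_one, add_sub_cancel_left, hΓs,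
      Real.log_mul hs0.ne' hΓ.ne', add_sub_cancel_right] using h
  rw [le_div_iff₀ ha] at hslope
  have hΓs0 : 0 < Real.Gamma s := hΓs ▸ mul_pos hs0 hΓ
  rw [← Real.log_le_log_iff (by positivity) hΓsa, Real.log_mul (by positivity) hΓs0.ne',
    Real.log_rpow hs0]
  linarith

theorem tendsto_Gamma_div_Gamma_add_atTop {a : ℝ} (ha : 0 < a) :
    Tendsto (fun s => Real.Gamma s / Real.Gamma (s + a)) atTop (𝓝 0) := by
  have hbound : Tendsto (fun s : ℝ => (s - 1) ^ (-a)) atTop (𝓝 0) :=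
    (tendsto_rpow_neg_atTop ha).comp (tendsto_atTop_add_const_right _ (-1) tendsto_id)
  refine squeeze_zero' ?_ ?_ hbound
  · filter_upwards [eventually_gt_atTop 0] with s hs
    have := Real.Gamma_pos_of_pos hs
    have := Real.Gamma_pos_of_pos (add_pos hs ha)
    positivity
  · filter_upwards [eventually_gt_atTop 1] with s hs
    have hs0 : 0 < s - 1 := sub_pos.2 hs
    rw [div_le_iff₀ (Real.Gamma_pos_of_pos (by linarith)), Real.rpow_neg hs0.le,
      ← div_eq_inv_mul, le_div_iff₀' (by positivity)]
    exact rpow_mul_Gamma_le_Gamma_add hs ha.le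

theorem summable_mittagLeffler {η : ℝ} (hη : 0 < η) (ν τ w : ℝ) :
    Summable fun j : ℕ => (Real.Gamma (τ + j) / Real.Gamma τ) /
      ((j.factorial : ℝ) * Real.Gamma (η * j + ν)) * w ^ j := by
  set c : ℕ → ℝ := fun j => (Real.Gamma (τ + j) / Real.Gamma τ) /
    ((j.factorial : ℝ) * Real.Gamma (η * j + ν)) * w ^ j
  set q : ℕ → ℝ := fun j => (τ + j) / (1 + j) *
    (Real.Gamma (η * j + ν) / Real.Gamma (η * j + ν + η)) * w
  have hlin : Tendsto (fun j : ℕ => η * (j : ℝ) + ν) atTop atTop :=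
    tendsto_atTop_add_const_right _ _ (tendsto_natCast_atTop_atTop.const_mul_atTop hη)
  have hq : Tendsto q atTop (𝓝 0) := by
    have hτ : Tendsto (fun j : ℕ => (τ + j) / (1 + j)) atTop (𝓝 1) := by
      simpa using tendsto_add_mul_div_add_mul_atTop_nhds τ 1 1 one_ne_zero
    simpa using (hτ.mul ((tendsto_Gamma_div_Gamma_add_atTop hη).comp hlin)).mul_const w
  have hratio : ∀ᶠ j in atTop, c (j + 1) = q j * c j := by
    filter_upwards [hlin.eventually_gt_atTop 0,
      tendsto_natCast_atTop_atTop.eventually_gt_atTop (-τ)] with j hj hjτ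
    have hΓ := (Real.Gamma_pos_of_pos hj).ne'
    have hτj : Real.Gamma (τ + (j + 1 : ℕ)) = (τ + j) * Real.Gamma (τ + j) := by
      rw [Nat.cast_succ, ← add_assoc, Real.Gamma_add_one (by linarith)]
    have harg : η * ((j + 1 : ℕ) : ℝ) + ν = η * j + ν + η := by push_cast; ring
    simp only [c, q, hτj, harg, Nat.factorial_succ, pow_succ]
    push_cast
    generalize Real.Gamma (η * j + ν) = g at hΓ
    field_simp
    ring
  refine summable_of_ratio_norm_eventually_le (r := 1 / 2) (by norm_num) ?_
  have hq_le : ∀ᶠ j in atTop, ‖q j‖ ≤ 1 / 2 :=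
    hq.norm.eventually_le_const (by norm_num)
  filter_upwards [hratio, hq_le] with j hj hqj
  rw [hj, norm_mul]
  gcongr

section NegativeMoments

theorem lintegral_rpow_mul_exp_neg_mul_Ioi {s y : ℝ} (hs : 0 < s) (hy : 0 < y) :
    ∫⁻ t in Set.Ioi (0 : ℝ), ENNReal.ofReal (t ^ (s - 1) * Real.exp (-(t * y))) =
      ENNReal.ofReal (y ^ (-s)) * ENNReal.ofReal (Real.Gamma s) := by
  have := Real.Gamma_pos_of_pos hs
  have heuler : ∫ t in Set.Ioi (0 : ℝ), t ^ (s - 1) * Real.exp (-(t * y)) =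
      y ^ (-s) * Real.Gamma s := by
    simp only [mul_comm _ y]
    rw [Real.integral_rpow_mul_exp_neg_mul_Ioi hs hy, one_div, Real.inv_rpow hy.le,
      Real.rpow_neg hy.le]
  rw [← ofReal_integral_eq_lintegral_ofReal, heuler, ENNReal.ofReal_mul (by positivity)]
  · exact .of_integral_ne_zero (by rw [heuler]; positivity)
  · filter_upwards [ae_restrict_mem measurableSet_Ioi] with t ht
    exact mul_nonneg (Real.rpow_nonneg (le_of_lt ht) _) (Real.exp_nonneg _)

variable {Ω : Type*} [MeasurableSpace Ω] {P : Measure Ω}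

theorem lintegral_rpow_neg_mul_Gamma [SFinite P] {Y : Ω → ℝ} (hY : AEMeasurable Y P)
    (hpos : ∀ᵐ ω ∂P, 0 < Y ω) {s : ℝ} (hs : 0 < s) :
    (∫⁻ ω, ENNReal.ofReal (Y ω ^ (-s)) ∂P) * ENNReal.ofReal (Real.Gamma s) =
      ∫⁻ t in Set.Ioi (0 : ℝ),
        ∫⁻ ω, ENNReal.ofReal (t ^ (s - 1) * Real.exp (-(t * Y ω))) ∂P := by
  have : AEMeasurable (fun p : Ω × ℝ => Y p.1) (P.prod (volume.restrict (Set.Ioi 0))) :=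
    hY.comp_fst
  rw [← lintegral_mul_const'' _ (by fun_prop), ← lintegral_lintegral_swap]
  · exact lintegral_congr_ae
      (hpos.mono fun ω hω => (lintegral_rpow_mul_exp_neg_mul_Ioi hs hω).symm)
  · unfold Function.uncurry
    fun_prop

namespace IsPositiveStable

variable {S : Ω → ℝ} {α s τ : ℝ}

theorem isProbabilityMeasure (hS : IsPositiveStable S P α) (hα : α ≠ 0) :
    IsProbabilityMeasure P := by
  have h := hS.laplace 0 le_rfl
  simp only [zero_mul, neg_zero, Real.exp_zero, Real.zero_rpow hα, integral_const,
    smul_eq_mul, mul_one] at h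
  exact isProbabilityMeasure_iff_real.2 h

theorem lintegral_mul_exp_neg (hS : IsPositiveStable S P α) {c t : ℝ} (hc : 0 ≤ c) (ht : 0 ≤ t) :
    ∫⁻ ω, ENNReal.ofReal (c * Real.exp (-(t * S ω))) ∂P =
      ENNReal.ofReal (c * Real.exp (-(t ^ α))) := by
  have hint : Integrable (fun ω => Real.exp (-(t * S ω))) P :=
    .of_integral_ne_zero (by rw [hS.laplace t ht]; positivity)
  rw [← hS.laplace t ht, ← integral_const_mul, ofReal_integral_eq_lintegral_ofReal
    (hint.const_mul c) (.of_forall fun ω => by positivity)]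

theorem lintegral_rpow_neg (hS : IsPositiveStable S P α) (hα : 0 < α) (hs : 0 < s) :
    ∫⁻ ω, ENNReal.ofReal (S ω ^ (-s)) ∂P =
      ENNReal.ofReal (Real.Gamma (s / α) / (α * Real.Gamma s)) := by
  have := hS.isProbabilityMeasure hα.ne'
  have hΓ := Real.Gamma_pos_of_pos hs
  have hmellin : ∫⁻ t in Set.Ioi (0 : ℝ), ENNReal.ofReal (t ^ (s - 1) * Real.exp (-(t ^ α))) =
      ENNReal.ofReal (1 / α * Real.Gamma (s / α)) := by
    have hval := integral_rpow_mul_exp_neg_rpow hα (q := s - 1) (by linarith)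
    rw [sub_add_cancel] at hval
    rw [← hval, ofReal_integral_eq_lintegral_ofReal
      (integrableOn_rpow_mul_exp_neg_rpow (by linarith) hα)]
    filter_upwards [ae_restrict_mem measurableSet_Ioi] with t ht
    exact mul_nonneg (Real.rpow_nonneg (le_of_lt ht) _) (Real.exp_nonneg _)
  have hprod := lintegral_rpow_neg_mul_Gamma hS.aemeasurable hS.pos hs
  rw [setLIntegral_congr_fun measurableSet_Ioi fun t (ht : 0 < t) =>
    hS.lintegral_mul_exp_neg (Real.rpow_nonneg ht.le _) ht.le, hmellin] at hprod
  rw [mul_comm, ← ENNReal.eq_div_iff (ENNReal.ofReal_pos.2 hΓ).ne' ENNReal.ofReal_ne_top] at hprod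
  rw [hprod, ← ENNReal.ofReal_div_of_pos hΓ]
  congr 1
  field_simp

theorem integral_rpow_neg (hS : IsPositiveStable S P α) (hα : 0 < α) (hs : 0 < s) :
    ∫ ω, S ω ^ (-s) ∂P = Real.Gamma (s / α) / (α * Real.Gamma s) := by
  have := Real.Gamma_pos_of_pos hs
  have := Real.Gamma_pos_of_pos (div_pos hs hα)
  rw [integral_eq_lintegral_of_nonneg_ae (hS.pos.mono fun ω hω => Real.rpow_nonneg hω.le _)
    (hS.aemeasurable.pow_const _).aestronglyMeasurable, hS.lintegral_rpow_neg hα hs,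
    ENNReal.toReal_ofReal (by positivity)]

theorem integrable_rpow_neg (hS : IsPositiveStable S P α) (hα : 0 < α) (hs : 0 < s) :
    Integrable (fun ω => S ω ^ (-s)) P := by
  refine .of_integral_ne_zero ?_
  have := Real.Gamma_pos_of_pos hs
  have := Real.Gamma_pos_of_pos (div_pos hs hα)
  rw [hS.integral_rpow_neg hα hs]
  positivity

end IsPositiveStable

end NegativeMoments

theorem hasSum_rpow_neg_mul_exp (α τ w : ℝ) {y : ℝ} (hy : 0 < y) :
    HasSum (fun j : ℕ => w ^ j / (j.factorial : ℝ) * y ^ (-(α * (τ + j))))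
      (y ^ (-(α * τ)) * Real.exp (w * y ^ (-α))) := by
  have hexp := (NormedSpace.expSeries_div_hasSum_exp (w * y ^ (-α))).mul_left (y ^ (-(α * τ)))
  rw [← Real.exp_eq_exp_ℝ] at hexp
  refine hexp.congr_fun fun j => ?_
  rw [show -(α * (τ + j)) = -(α * τ) + -α * j by ring, Real.rpow_add hy,
    Real.rpow_mul_natCast hy.le, mul_pow]
  ring

namespace IsPositiveStable

variable {Ω : Type*} [MeasurableSpace Ω] {P : Measure Ω} {S : Ω → ℝ} {α τ : ℝ}

theorem integral_pow_div_factorial_mul_rpow_neg (hS : IsPositiveStable S P α) (hα : 0 < α)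
    (hτ : 0 < τ) (w : ℝ) (j : ℕ) :
    ∫ ω, w ^ j / (j.factorial : ℝ) * S ω ^ (-(α * (τ + j))) ∂P =
      Real.Gamma τ / α * ((Real.Gamma (τ + j) / Real.Gamma τ) /
        ((j.factorial : ℝ) * Real.Gamma (α * j + α * τ)) * w ^ j) := by
  have hΓ := (Real.Gamma_pos_of_pos hτ).ne'
  rw [integral_const_mul, hS.integral_rpow_neg hα (by positivity), mul_div_cancel_left₀ _ hα.ne',
    show α * (τ + j) = α * j + α * τ by ring]
  field_simp

theorem integral_rpow_neg_mul_exp (hS : IsPositiveStable S P α) (hα : 0 < α) (hτ : 0 < τ)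
    (w : ℝ) :
    ∫ ω, S ω ^ (-(α * τ)) * Real.exp (w * S ω ^ (-α)) ∂P =
      Real.Gamma τ / α * mittagLeffler α (α * τ) τ w := by
  have hint : ∀ j : ℕ,
      Integrable (fun ω => w ^ j / (j.factorial : ℝ) * S ω ^ (-(α * (τ + j)))) P :=
    fun j => (hS.integrable_rpow_neg hα (by positivity)).const_mul _
  have hnorm : ∀ j : ℕ, ∫ ω, ‖w ^ j / (j.factorial : ℝ) * S ω ^ (-(α * (τ + j)))‖ ∂P =
      ∫ ω, |w| ^ j / (j.factorial : ℝ) * S ω ^ (-(α * (τ + j))) ∂P := fun j =>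
    integral_congr_ae <| hS.pos.mono fun ω hω => by
      simp only [norm_mul, norm_div, norm_pow, Real.norm_natCast, Real.norm_eq_abs w,
        Real.norm_of_nonneg (Real.rpow_nonneg hω.le _)]
  have hsummable : Summable fun j : ℕ =>
      ∫ ω, ‖w ^ j / (j.factorial : ℝ) * S ω ^ (-(α * (τ + j)))‖ ∂P := by
    simp only [hnorm, hS.integral_pow_div_factorial_mul_rpow_neg hα hτ]
    exact (summable_mittagLeffler hα _ _ _).mul_left _
  calc ∫ ω, S ω ^ (-(α * τ)) * Real.exp (w * S ω ^ (-α)) ∂P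
      = ∫ ω, ∑' j : ℕ, w ^ j / (j.factorial : ℝ) * S ω ^ (-(α * (τ + j))) ∂P :=
        integral_congr_ae <| hS.pos.mono fun ω hω =>
          (hasSum_rpow_neg_mul_exp α τ w hω).tsum_eq.symm
    _ = ∑' j : ℕ, ∫ ω, w ^ j / (j.factorial : ℝ) * S ω ^ (-(α * (τ + j))) ∂P :=
        (integral_tsum_of_summable_integral_norm hint hsummable).symm
    _ = Real.Gamma τ / α * mittagLeffler α (α * τ) τ w := by
        simp only [hS.integral_pow_div_factorial_mul_rpow_neg hα hτ, tsum_mul_left, mittagLeffler]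

theorem integrable_rpow_neg_mul_exp (hS : IsPositiveStable S P α) (hα : 0 < α) (hτ : 0 < τ)
    {w : ℝ} (hw : w ≤ 0) :
    Integrable (fun ω => S ω ^ (-(α * τ)) * Real.exp (w * S ω ^ (-α))) P := by
  refine (hS.integrable_rpow_neg hα (mul_pos hα hτ)).mul_bdd (c := 1)
    (Measurable.comp_aemeasurable (g := fun y => Real.exp (w * y ^ (-α))) (by fun_prop)
      hS.aemeasurable).aestronglyMeasurable (hS.pos.mono fun ω hω => ?_)
  rw [Real.norm_of_nonneg (Real.exp_nonneg _), Real.exp_le_one_iff]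
  exact mul_nonpos_of_nonpos_of_nonneg hw (Real.rpow_nonneg hω.le _)

theorem restrict_map_Ioi (hS : IsPositiveStable S P α) :
    (P.map S).restrict (Set.Ioi 0) = P.map S :=
  Measure.restrict_eq_self_of_ae_mem ((ae_map_iff hS.aemeasurable measurableSet_Ioi).2 hS.pos)

end IsPositiveStable

theorem gfPdMass_eq_mittagLeffler {α δ : ℝ} (hα : 0 < α) (hδ : 0 < δ) (μ : ℝ) (x : ℕ) :
    gfPdMass α (α * δ) δ μ x =
      Real.Gamma (α * δ + 1) / Real.Gamma (δ + 1) * (μ ^ x / (x.factorial : ℝ)) *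
        (Real.Gamma (x + δ) / α * mittagLeffler α (α * (x + δ)) (x + δ) (-μ)) := by
  have := Real.Gamma_pos_of_pos hδ
  rw [gfPdMass, Real.Gamma_add_one hδ.ne', Real.Gamma_add_one (mul_pos hα hδ).ne', add_comm δ,
    ← mul_add]
  field_simp

theorem mainTheorem2_general {α δ μ : ℝ} (hα : 0 < α) (hδ : 0 < δ) (hμ : 0 ≤ μ)
    {Ω : Type*} [MeasurableSpace Ω] {P : Measure Ω} {X : Ω → ℕ} (hX : HasGfPd X P α (α * δ) δ μ)
    {Ω' : Type*} [MeasurableSpace Ω'] {P' : Measure Ω'} {S : Ω' → ℝ}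
    (hS : IsPositiveStable S P' α) (x : ℕ) :
    IntegrableOn (fun y : ℝ => y ^ (-(α * (x + δ))) * Real.exp (-(μ * y ^ (-α))))
      (Set.Ioi 0) (P'.map S) ∧
    P.real {ω | X ω = x} =
      Real.Gamma (α * δ + 1) / Real.Gamma (δ + 1) * (μ ^ x / (x.factorial : ℝ)) *
        ∫ y in Set.Ioi (0 : ℝ), y ^ (-(α * (x + δ))) * Real.exp (-(μ * y ^ (-α)))
          ∂(P'.map S) := by
  have hτ : 0 < x + δ := by positivity
  have hmeas : Measurable fun y : ℝ => y ^ (-(α * (x + δ))) * Real.exp (-μ * y ^ (-α)) := by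
    fun_prop
  simp only [← neg_mul μ]
  rw [IntegrableOn, hS.restrict_map_Ioi]
  constructor
  · rw [integrable_map_measure hmeas.aestronglyMeasurable hS.aemeasurable]
    exact hS.integrable_rpow_neg_mul_exp hα hτ (neg_nonpos.2 hμ)
  · rw [integral_map hS.aemeasurable hmeas.aestronglyMeasurable, hX.mass x,
      gfPdMass_eq_mittagLeffler hα hδ, hS.integral_rpow_neg_mul_exp hα hτ]

theorem mainTheorem2 (α μ : ℝ) (hα0 : 0 < α) (hα1 : α ≤ 1) (hμ : 0 < μ)
    {Ω : Type*} [MeasurableSpace Ω] (P : Measure Ω) [IsProbabilityMeasure P]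
    (X : Ω → ℕ) (hX : HasGfPd X P α α 1 μ)
    {Ω' : Type*} [MeasurableSpace Ω'] (P' : Measure Ω') [IsProbabilityMeasure P']
    (S : Ω' → ℝ) (hS : IsPositiveStable S P' α) (x : ℕ) :
    IntegrableOn (fun y : ℝ => y ^ (-(α * (x + 1))) * Real.exp (-(μ * y ^ (-α))))
      (Set.Ioi 0) (P'.map S) ∧
    P.real {ω | X ω = x} =
      Real.Gamma (α + 1) * (μ ^ x / (x.factorial : ℝ)) *
        ∫ y in Set.Ioi (0 : ℝ), y ^ (-(α * (x + 1))) * Real.exp (-(μ * y ^ (-α)))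
          ∂(P'.map S) := by
  simpa [one_add_one_eq_two] using
    mainTheorem2_general hα0 one_pos hμ.le ((mul_one α).symm ▸ hX) hS x
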